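/- Query model. Let $\mathbb F$ be a finite field. A quantum query algorithm of dimension $n$ over $\mathbb F$ acts on a matrix-query register $|j,k,z\rangle$, a vector-query register $|j,z\rangle$ ($j,k\in[n]$, $z\in\mathbb F$), an output register $|y\rangle$ ($y\in\mathbb F^n$) and a finite-dimensional workspace. It starts in a fixed computational basis state $|0\rangle$ and applies a fixed finite sequence of steps, each of which is an arbitrary unitary that does not depend on the input, one query to $U_M:|j,k,z\rangle\mapsto|j,k,z+M_{jk}\rangle$, or one query to $U_v:|j,z\rangle\mapsto|j,z+v_j\rangle$. For an input $M\in\mathbb F^{n\times n}$, $v\in\mathbb F^n$, write $\Pr[\mathsf{ALG}^{M,v}=Mv]=\|\Pi_{Mv}\,\mathsf{ALG}^{M,v}|0\rangle\|^2$ for the probability that measuring the output register at the end in the standard basis gives $Mv$. Statement. There is an absolute constant $C>0$ such that the following holds. Let $\mathbb F$ be a finite field, let $n,k,d$ be positive integers with $n=kd$, and let $\alpha\in(0,1]$ satisfy $\alpha\ge 4\exp(-k/3200)$. Suppose that $\mathsf{ALG}$ is a quantum query algorithm of dimension $n$ over $\mathbb F$ that makes at most $Q$ queries to $U_M$ (and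 any number of queries to $U_v$) and satisfies $$\mathop{\mathbb E}_{M\in\mathbb F^{n\times n},\,v\in\mathbb F^n}\bigl[\|\Pi_{Mv}\,\mathsf{ALG}^{M,v}|0\rangle\|^2\bigr]\ge\alpha ,$$ where $M$ and $v$ are independent and uniformly random. Then there is a quantum query algorithm $\mathsf{ALG}_4$ of dimension $d$ over $\mathbb F$ that makes in total at most $C\,\alpha^{-2}\,(Q+n^{3/2})$ queries to its oracles $U_M$ and $U_v$ and that satisfies, for every $M\in\mathbb F^{d\times d}$ and every $v\in\mathbb F^d$, $$\Pr_{\mathsf{ALG}_4}\bigl[\mathsf{ALG}_4^{M,v}=Mv\bigr]\ge 0.96 .$$ -/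

import Mathlib

open scoped Matrix

/-- Labels of the computational basis of a query algorithm for inputs `M ∈ F^{n×n}`, `v ∈ F^n`:
the matrix-query register `|j, k, z⟩`, the vector-query register `|j, z⟩`, the output register
`|y⟩` with `y ∈ F^n`, and a workspace register `|w⟩`. -/
abbrev QBasis (F : Type) (n : ℕ) (W : Type) : Type :=
  (Fin n × Fin n × F) × (Fin n × F) × (Fin n → F) × W

section

variable {F : Type} [Field F] [Fintype F] [DecidableEq F] {n : ℕ}

/-- The action of `U_M : |j, k, z⟩ ↦ |j, k, z + M j k⟩` on basis labels (the identity on the other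
registers). -/
def matrixQueryMap {W : Type} (M : Matrix (Fin n) (Fin n) F) :
    QBasis F n W → QBasis F n W
  | ((j, k, z), r) => ((j, k, z + M j k), r)

/-- The action of `U_v : |j, z⟩ ↦ |j, z + v j⟩` on basis labels (the identity on the other
registers). -/
def vectorQueryMap {W : Type} (v : Fin n → F) :
    QBasis F n W → QBasis F n W
  | (q, (j, z), r) => (q, (j, z + v j), r)

/-- The linear map `|b⟩ ↦ |f b⟩`, as a matrix in the computational basis. -/
def basisMapMatrix {B : Type} [DecidableEq B] (f : B → B) : Matrix B B ℂ :=
  Matrix.of fun b' b => if b' = f b then 1 else 0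

/-- One step of a query algorithm: a unitary on all registers that does not depend on the input,
one query to `U_M`, or one query to `U_v`. -/
inductive QGate (F : Type) [Fintype F] [DecidableEq F] (n : ℕ)
    (W : Type) [Fintype W] [DecidableEq W] : Type
  | unitary (U : Matrix.unitaryGroup (QBasis F n W) ℂ)
  | queryMatrix
  | queryVector

namespace QGate

variable {W : Type} [Fintype W] [DecidableEq W]

/-- The operator that a step applies on input `M`, `v`. -/
def toMatrix (M : Matrix (Fin n) (Fin n) F) (v : Fin n → F) :
    QGate F n W → Matrix (QBasis F n W) (QBasis F n W) ℂ
  | unitary U => (U : Matrix (QBasis F n W) (QBasis F n W) ℂ)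
  | queryMatrix => basisMapMatrix (matrixQueryMap M)
  | queryVector => basisMapMatrix (vectorQueryMap v)

/-- Number of queries to `U_M` made by a step. -/
def matrixCost : QGate F n W → ℕ
  | queryMatrix => 1
  | _ => 0

/-- Number of queries to `U_v` made by a step. -/
def vectorCost : QGate F n W → ℕ
  | queryVector => 1
  | _ => 0

end QGate

/-- A quantum query algorithm with oracle access to a matrix in `F^{n×n}` and a vector in `F^n` and
with an output in `F^n`: a finite workspace, an initial computational basis state, and a
sequence of steps (executed from the head of the list on). -/
structure QueryAlgorithm (F : Type) [Fintype F] [DecidableEq F] (n : ℕ) where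
  W : Type
  [fintypeW : Fintype W]
  [decEqW : DecidableEq W]
  init : QBasis F n W
  gates : List (QGate F n W)

attribute [instance] QueryAlgorithm.fintypeW QueryAlgorithm.decEqW

namespace QueryAlgorithm

/-- Number of queries to `U_M`. -/
def matrixQueries (A : QueryAlgorithm F n) : ℕ := (A.gates.map QGate.matrixCost).sum

/-- Number of queries to `U_v`. -/
def vectorQueries (A : QueryAlgorithm F n) : ℕ := (A.gates.map QGate.vectorCost).sum

/-- The final state of the algorithm on input `M`, `v`. -/
def finalState (A : QueryAlgorithm F n) (M : Matrix (Fin n) (Fin n) F) (v : Fin n → F) :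
    QBasis F n A.W → ℂ :=
  A.gates.foldl (fun ψ g => g.toMatrix M v *ᵥ ψ) (Pi.single A.init 1)

/-- The probability that measuring the output register of the final state in the standard basis
gives `y`, that is, the squared norm of the projection of the final state to output `y`. -/
noncomputable def outputProb (A : QueryAlgorithm F n) (M : Matrix (Fin n) (Fin n) F)
    (v y : Fin n → F) : ℝ :=
  ∑ b : QBasis F n A.W, if b.2.2.1 = y then ‖A.finalState M v b‖ ^ 2 else 0

/-- The probability of the output `M v` on input `M`, `v`. -/
noncomputable def successProb (A : QueryAlgorithm F n) (M : Matrix (Fin n) (Fin n) F)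
    (v : Fin n → F) : ℝ :=
  A.outputProb M v (M *ᵥ v)

/-- The success probability averaged over uniformly random independent `M` and `v`. -/
noncomputable def averageSuccess (A : QueryAlgorithm F n) : ℝ :=
  (∑ M : Matrix (Fin n) (Fin n) F, ∑ v : Fin n → F, A.successProb M v) /
    ((Fintype.card (Matrix (Fin n) (Fin n) F) : ℝ) * (Fintype.card (Fin n → F) : ℝ))

end QueryAlgorithm

end

/-!
The theorem holds because its average-case hypothesis is already as expensive as reading the whole
input: an algorithm with fewer than `n² / 200` queries to `U_M` has average success probability at
most `2 exp (-n / 25)`, however often it queries `U_v` (`QueryAlgorithm.averageSuccess_le`). As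
`k ≤ n`, this is below the threshold `4 exp (-k / 3200)`, so the given algorithm satisfies
`n² ≤ 200 Q`. The bound `400 α⁻² Q` then pays for the `d² + d ≤ 2 n²` queries of the algorithm of
dimension `d` that copies its input to the workspace and multiplies there
(`QueryAlgorithm.bruteForce`), which is correct on every input. This `d`-dimensional algorithm does
not call the given one, which enters only through its query count.

The lower bound is the polynomial method over the characters of the group `F^{n×n}`. For fixed `v`,
every amplitude of the final state is, as a function of `M`, a combination of characters
`M ↦ χ (∑ j k, S j k * M j k)` in which `S` has at most as many nonzero entries as there are queries
to `U_M` (`QueryAlgorithm.finalState_mem_lowWeight`). The indicator of the event `M v = y` is an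
average, over all vectors `u`, of multiples of the characters of `S = u vᵀ`. By Parseval and Schur's
test, the share of the mass of a low-weight function on this event is therefore at most the
proportion of the `u` for which adding `u vᵀ` to a given matrix leaves it of low weight
(`sum_fibre_norm_sq_le`). If `v` has more than `n / 10` nonzero entries, then in each row at most one
value of `u i` leaves the row with at most `n / 20` nonzero entries, and a Chernoff bound shows that
this rarely happens in nine tenths of the rows (`card_lightShifts_le`). The same Chernoff bound shows
that sparse `v` are rare (`card_sparse_le`).
-/

set_option linter.unusedSectionVars false

section

variable {F : Type} [Field F] [Fintype F] [DecidableEq F] {n : ℕ}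

/-! ### Characters on matrices -/

/-- The character `M ↦ χ (∑ j k, S j k * M j k)` of the additive group of `n × n` matrices. -/
def matrixChar (χ : AddChar F ℂ) (S : Matrix (Fin n) (Fin n) F) :
    AddChar (Matrix (Fin n) (Fin n) F) ℂ where
  toFun M := χ (∑ j, ∑ k, S j k * M j k)
  map_zero_eq_one' := by simp
  map_add_eq_mul' M N := by
    simp only [Matrix.add_apply, mul_add, Finset.sum_add_distrib, AddChar.map_add_eq_mul]

lemma matrixChar_apply (χ : AddChar F ℂ) (S M : Matrix (Fin n) (Fin n) F) :
    matrixChar χ S M = χ (∑ j, ∑ k, S j k * M j k) := rfl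

lemma matrixChar_zero (χ : AddChar F ℂ) : matrixChar χ (0 : Matrix (Fin n) (Fin n) F) = 0 := by
  ext M
  simp [matrixChar_apply]

lemma matrixChar_add (χ : AddChar F ℂ) (S T M : Matrix (Fin n) (Fin n) F) :
    matrixChar χ (S + T) M = matrixChar χ S M * matrixChar χ T M := by
  simp only [matrixChar_apply, Matrix.add_apply, add_mul, Finset.sum_add_distrib,
    AddChar.map_add_eq_mul]

lemma matrixChar_neg (χ : AddChar F ℂ) (S M : Matrix (Fin n) (Fin n) F) :
    matrixChar χ (-S) M = starRingEnd ℂ (matrixChar χ S M) := by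
  simp only [matrixChar_apply, Matrix.neg_apply, neg_mul, Finset.sum_neg_distrib,
    AddChar.map_neg_eq_conj]

lemma sum_single_mul (j k : Fin n) (c : F) (M : Matrix (Fin n) (Fin n) F) :
    ∑ a, ∑ b, Matrix.single j k c a b * M a b = c * M j k := by
  rw [Finset.sum_eq_single j, Finset.sum_eq_single k]
  · simp
  · intro b _ hb; simp [hb.symm]
  · simp
  · intro a _ ha; simp [ha.symm]
  · simp

lemma matrixChar_single (χ : AddChar F ℂ) (j k : Fin n) (c : F)
    (M : Matrix (Fin n) (Fin n) F) :
    matrixChar χ (Matrix.single j k c) M = χ (c * M j k) := by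
  rw [matrixChar_apply, sum_single_mul]

lemma matrixChar_vecMulVec (χ : AddChar F ℂ) (u v : Fin n → F)
    (M : Matrix (Fin n) (Fin n) F) :
    matrixChar χ (Matrix.vecMulVec u v) M = χ (u ⬝ᵥ M *ᵥ v) := by
  rw [matrixChar_apply]
  congr 1
  simp only [dotProduct, Matrix.mulVec, Matrix.vecMulVec_apply, Finset.mul_sum]
  exact Finset.sum_congr rfl fun j _ => Finset.sum_congr rfl fun k _ => by ring

lemma matrixChar_eq_zero_iff {χ : AddChar F ℂ} (hχ : χ.IsPrimitive)
    (S : Matrix (Fin n) (Fin n) F) : matrixChar χ S = 0 ↔ S = 0 := by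
  refine ⟨fun h => ?_, fun h => h ▸ matrixChar_zero χ⟩
  ext j k
  by_contra hne
  refine hχ hne ?_
  ext x
  have := DFunLike.congr_fun h (Matrix.single j k x)
  rw [matrixChar_apply] at this
  simp only [mul_comm (S _ _), sum_single_mul] at this
  simpa [AddChar.mulShift_apply, mul_comm] using this

lemma sum_matrixChar {χ : AddChar F ℂ} (hχ : χ.IsPrimitive) (S : Matrix (Fin n) (Fin n) F) :
    ∑ M, matrixChar χ S M =
      if S = 0 then (Fintype.card (Matrix (Fin n) (Fin n) F) : ℂ) else 0 := by
  classical
  rw [AddChar.sum_eq_ite]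
  simp only [matrixChar_eq_zero_iff hχ]

/-- Multiplying by the character of `R` shifts the Fourier coefficients by `R`. For `R = 0` this is
Parseval's identity. -/
lemma sum_matrixChar_mul_mul_conj {χ : AddChar F ℂ} (hχ : χ.IsPrimitive)
    (c : Matrix (Fin n) (Fin n) F → ℂ) (R : Matrix (Fin n) (Fin n) F) :
    ∑ M, matrixChar χ R M * ((∑ S, c S * matrixChar χ S M) *
        starRingEnd ℂ (∑ S, c S * matrixChar χ S M)) =
      Fintype.card (Matrix (Fin n) (Fin n) F) * ∑ S, c S * starRingEnd ℂ (c (S + R)) := by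
  have expand : ∀ M, matrixChar χ R M * ((∑ S, c S * matrixChar χ S M) *
        starRingEnd ℂ (∑ S, c S * matrixChar χ S M)) =
      ∑ S, ∑ T, c S * starRingEnd ℂ (c T) * matrixChar χ (S + R + -T) M := by
    intro M
    rw [map_sum, Finset.sum_mul_sum, Finset.mul_sum]
    refine Finset.sum_congr rfl fun S _ => ?_
    rw [Finset.mul_sum]
    refine Finset.sum_congr rfl fun T _ => ?_
    rw [matrixChar_add, matrixChar_add, matrixChar_neg, map_mul]
    ring
  simp only [expand]
  rw [Finset.sum_comm, Finset.mul_sum]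
  refine Finset.sum_congr rfl fun S _ => ?_
  rw [Finset.sum_comm]
  simp only [← Finset.mul_sum, sum_matrixChar hχ]
  rw [Finset.sum_eq_single (S + R)]
  · simp; ring
  · intro T _ hT
    rw [if_neg, mul_zero]
    intro h
    exact hT (add_neg_eq_zero.mp h).symm
  · simp

/-! ### The span of the characters of low weight -/

/-- The Hamming weight of a matrix. -/
def matrixWeight (S : Matrix (Fin n) (Fin n) F) : ℕ :=
  ∑ j, hammingNorm (S j)

lemma matrixWeight_single_le (j k : Fin n) (c : F) :
    matrixWeight (Matrix.single j k c) ≤ 1 := by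
  unfold matrixWeight
  rw [Finset.sum_eq_single j]
  · unfold hammingNorm
    rw [Finset.card_le_one]
    intro a ha b hb
    have h : ∀ i, Matrix.single j k c j i ≠ 0 → i = k := fun i hi => by
      by_contra hik
      exact hi (by simp [Ne.symm hik])
    rw [h a (Finset.mem_filter.mp ha).2, h b (Finset.mem_filter.mp hb).2]
  · intro a _ ha
    rw [hammingNorm_eq_zero]
    ext b
    simp [ha.symm]
  · simp

lemma matrixWeight_add_le (S T : Matrix (Fin n) (Fin n) F) :
    matrixWeight (S + T) ≤ matrixWeight S + matrixWeight T := by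
  unfold matrixWeight
  rw [← Finset.sum_add_distrib]
  refine Finset.sum_le_sum fun j _ => ?_
  unfold hammingNorm
  refine (Finset.card_le_card ?_).trans (Finset.card_union_le _ _)
  intro k
  simp only [Finset.mem_filter, Finset.mem_union, Finset.mem_univ, true_and, Matrix.add_apply]
  grind

/-- The functions of a matrix that are combinations of characters of Hamming weight at most `t`. -/
def lowWeight (χ : AddChar F ℂ) (n t : ℕ) : Submodule ℂ (Matrix (Fin n) (Fin n) F → ℂ) :=
  Submodule.span ℂ ((fun S => ⇑(matrixChar χ S)) '' {S | matrixWeight S ≤ t})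

lemma matrixChar_mem_lowWeight (χ : AddChar F ℂ) {t : ℕ} {S : Matrix (Fin n) (Fin n) F}
    (hS : matrixWeight S ≤ t) : ⇑(matrixChar χ S) ∈ lowWeight χ n t :=
  Submodule.subset_span ⟨S, hS, rfl⟩

lemma const_mem_lowWeight (χ : AddChar F ℂ) (t : ℕ) (a : ℂ) :
    (fun _ => a) ∈ lowWeight χ n t := by
  have h : ⇑(matrixChar χ 0) ∈ lowWeight χ n t :=
    matrixChar_mem_lowWeight χ (by simp [matrixWeight, hammingNorm])
  convert (lowWeight χ n t).smul_mem a h using 1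
  ext M
  simp [matrixChar_zero]

lemma char_entry_mul_mem_lowWeight {χ : AddChar F ℂ} {t : ℕ}
    {f : Matrix (Fin n) (Fin n) F → ℂ} (hf : f ∈ lowWeight χ n t) (j k : Fin n) (c : F) :
    (fun M => χ (c * M j k) * f M) ∈ lowWeight χ n (t + 1) := by
  induction hf using Submodule.span_induction with
  | mem f hf =>
    obtain ⟨S, hS, rfl⟩ := hf
    have h := matrixChar_mem_lowWeight χ (t := t + 1) (S := Matrix.single j k c + S) <|
      (matrixWeight_add_le _ _).trans <| by
        have := matrixWeight_single_le j k c
        have : matrixWeight S ≤ t := hS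
        omega
    convert h using 1
    ext M
    rw [matrixChar_add, matrixChar_single]
  | zero => 
    convert (lowWeight χ n (t + 1)).zero_mem using 1
    ext M
    simp
  | add f g _ _ hf hg =>
    convert (lowWeight χ n (t + 1)).add_mem hf hg using 1
    ext M
    simp [mul_add]
  | smul a f _ hf =>
    convert (lowWeight χ n (t + 1)).smul_mem a hf using 1
    ext M
    simp only [Pi.smul_apply, smul_eq_mul]
    ring

/-- A test on a single entry raises the weight by at most one, since it is a combination of the
characters of that entry. -/
lemma ite_entry_eq_mem_lowWeight {χ : AddChar F ℂ} (hχ : χ.IsPrimitive) {t : ℕ}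
    {f : Matrix (Fin n) (Fin n) F → ℂ} (hf : f ∈ lowWeight χ n t) (j k : Fin n) (a : F) :
    (fun M => if M j k = a then f M else 0) ∈ lowWeight χ n (t + 1) := by
  have h : ∀ M : Matrix (Fin n) (Fin n) F, (if M j k = a then f M else 0) =
      ∑ c : F, ((Fintype.card F : ℂ)⁻¹ * χ (-(c * a))) * (χ (c * M j k) * f M) := by
    intro M
    have h1 := AddChar.sum_mulShift (M j k - a) hχ
    have h2 : ∀ c : F, ((Fintype.card F : ℂ)⁻¹ * χ (-(c * a))) * (χ (c * M j k) * f M) =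
        ((Fintype.card F : ℂ)⁻¹ * f M) * χ (c * (M j k - a)) := by
      intro c
      rw [mul_sub, sub_eq_add_neg, AddChar.map_add_eq_mul]
      ring
    simp only [h2]
    rw [← Finset.mul_sum, h1]
    by_cases hM : M j k = a
    · simp [hM, sub_self]
      field_simp
    · simp [hM, sub_eq_zero]
  simp only [h]
  convert (lowWeight χ n (t + 1)).sum_mem (t := Finset.univ)
    (f := fun c : F => ((Fintype.card F : ℂ)⁻¹ * χ (-(c * a))) •
      (fun M : Matrix (Fin n) (Fin n) F => χ (c * M j k) * f M))
    (fun c _ => Submodule.smul_mem _ _ (char_entry_mul_mem_lowWeight hf j k c)) using 1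
  ext M
  simp

lemma exists_coeff_of_mem_lowWeight {χ : AddChar F ℂ} {t : ℕ}
    {f : Matrix (Fin n) (Fin n) F → ℂ} (hf : f ∈ lowWeight χ n t) :
    ∃ c : Matrix (Fin n) (Fin n) F → ℂ, (∀ S, t < matrixWeight S → c S = 0) ∧
      ∀ M, f M = ∑ S, c S * matrixChar χ S M := by
  induction hf using Submodule.span_induction with
  | mem f hf =>
    obtain ⟨S, hS, rfl⟩ := hf
    refine ⟨Pi.single S 1, fun T hT => ?_, fun M => ?_⟩
    · have : T ≠ S := by rintro rfl; exact absurd hT (not_lt.mpr hS)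
      simp [this]
    · simp [Pi.single_apply]
  | zero => exact ⟨0, by simp, by simp⟩
  | add f g _ _ hf hg =>
    obtain ⟨c, hc, hfc⟩ := hf
    obtain ⟨d, hd, hgd⟩ := hg
    refine ⟨c + d, fun S hS => by simp [hc S hS, hd S hS], fun M => ?_⟩
    simp [hfc, hgd, add_mul, Finset.sum_add_distrib]
  | smul a f _ hf =>
    obtain ⟨c, hc, hfc⟩ := hf
    refine ⟨a • c, fun S hS => by simp [hc S hS], fun M => ?_⟩
    simp [hfc, Finset.mul_sum, mul_assoc]

/-! ### Concentration of low-weight functions on the fibres of `M ↦ M v` -/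

/-- The vectors `u` for which shifting by `u vᵀ` leaves `S` of weight at most `t`. -/
def lightShifts (t : ℕ) (v : Fin n → F) (S : Matrix (Fin n) (Fin n) F) : Finset (Fin n → F) :=
  {u | matrixWeight (S + Matrix.vecMulVec u v) ≤ t}

/-- Schur's test for the matrix `(S, T) ↦ #{u | T = S + u vᵀ}`, restricted to light `S` and `T`. -/
lemma sum_norm_mul_norm_shift_le {t : ℕ} {N : ℝ} {v : Fin n → F}
    (hN : ∀ S, ((lightShifts t v S).card : ℝ) ≤ N) {c : Matrix (Fin n) (Fin n) F → ℂ}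
    (hc : ∀ S, t < matrixWeight S → c S = 0) :
    ∑ u, ∑ S, ‖c S‖ * ‖c (S + Matrix.vecMulVec u v)‖ ≤ N * ∑ S, ‖c S‖ ^ 2 := by
  have key : ∀ S, ∑ u, (if matrixWeight (S + Matrix.vecMulVec u v) ≤ t then ‖c S‖ ^ 2 else 0)
      ≤ N * ‖c S‖ ^ 2 := by
    intro S
    rw [← Finset.sum_filter, Finset.sum_const, nsmul_eq_mul]
    gcongr
    exact hN S
  have h1 : ∑ u, ∑ S, (if matrixWeight (S + Matrix.vecMulVec u v) ≤ t then ‖c S‖ ^ 2 else 0)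
      ≤ N * ∑ S, ‖c S‖ ^ 2 := by
    rw [Finset.sum_comm, Finset.mul_sum]
    exact Finset.sum_le_sum fun S _ => key S
  have h2 : ∑ u, ∑ S, (if matrixWeight S ≤ t then ‖c (S + Matrix.vecMulVec u v)‖ ^ 2 else 0)
      ≤ N * ∑ S, ‖c S‖ ^ 2 := by
    refine le_trans (le_of_eq ?_) h1
    -- substitute `S - u vᵀ` for `S`, then `-u` for `u`
    rw [← Equiv.sum_comp (Equiv.neg (Fin n → F))]
    refine Finset.sum_congr rfl fun u _ => ?_
    rw [← Equiv.sum_comp (Equiv.addRight (Matrix.vecMulVec u v))]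
    refine Finset.sum_congr rfl fun S _ => ?_
    simp [Matrix.neg_vecMulVec, add_assoc]
  have h3 : ∀ u S, ‖c S‖ * ‖c (S + Matrix.vecMulVec u v)‖ ≤
      ((if matrixWeight (S + Matrix.vecMulVec u v) ≤ t then ‖c S‖ ^ 2 else 0) +
      (if matrixWeight S ≤ t then ‖c (S + Matrix.vecMulVec u v)‖ ^ 2 else 0)) / 2 := by
    intro u S
    by_cases hS : matrixWeight S ≤ t
    · by_cases hT : matrixWeight (S + Matrix.vecMulVec u v) ≤ t
      · rw [if_pos hS, if_pos hT]
        nlinarith [sq_nonneg (‖c S‖ - ‖c (S + Matrix.vecMulVec u v)‖)]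
      · rw [hc _ (not_le.mp hT)]
        simp [hT]
    · rw [hc _ (not_le.mp hS)]
      simp only [norm_zero, zero_mul]
      positivity
  calc _ ≤ ∑ u, ∑ S, ((if matrixWeight (S + Matrix.vecMulVec u v) ≤ t then ‖c S‖ ^ 2 else 0) +
      (if matrixWeight S ≤ t then ‖c (S + Matrix.vecMulVec u v)‖ ^ 2 else 0)) / 2 :=
        Finset.sum_le_sum fun u _ => Finset.sum_le_sum fun S _ => h3 u S
    _ ≤ _ := by
      simp only [← Finset.sum_div, Finset.sum_add_distrib]
      linarith

lemma sum_char_dotProduct {χ : AddChar F ℂ} (hχ : χ.IsPrimitive) (w : Fin n → F) :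
    ∑ u : Fin n → F, χ (u ⬝ᵥ w) = if w = 0 then (Fintype.card (Fin n → F) : ℂ) else 0 := by
  have h : ∀ u : Fin n → F, χ (u ⬝ᵥ w) = ∏ i, χ (u i * w i) := fun u => by
    exact map_prod χ.toMonoidHom (fun i => Multiplicative.ofAdd (u i * w i)) Finset.univ
  simp only [h]
  have := Finset.prod_univ_sum (fun _ : Fin n => (Finset.univ : Finset F))
    (fun i x => χ (x * w i))
  rw [Fintype.piFinset_univ] at this
  rw [← this]
  simp only [AddChar.sum_mulShift _ hχ]
  split_ifs with hw
  · simp [hw]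
  · obtain ⟨i, hi⟩ := Function.ne_iff.mp hw
    exact Finset.prod_eq_zero (Finset.mem_univ i) (by simpa using hi)

/-- A function of low weight has only a small part of its mass on a fibre of `M ↦ M v`: the
indicator of the fibre is an average of characters of the matrices `u vᵀ`, and few of the shifts by
these respect the weight bound. -/
lemma sum_fibre_norm_sq_le {χ : AddChar F ℂ} (hχ : χ.IsPrimitive) {t : ℕ} {N : ℝ} {v : Fin n → F}
    (hN : ∀ S, ((lightShifts t v S).card : ℝ) ≤ N) {f : Matrix (Fin n) (Fin n) F → ℂ}
    (hf : f ∈ lowWeight χ n t) (y : Fin n → F) :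
    Fintype.card (Fin n → F) * ∑ M : Matrix (Fin n) (Fin n) F,
        (if y = M *ᵥ v then ‖f M‖ ^ 2 else 0) ≤
      N * ∑ M, ‖f M‖ ^ 2 := by
  obtain ⟨c, hc, hfc⟩ := exists_coeff_of_mem_lowWeight hf
  have corr := sum_matrixChar_mul_mul_conj hχ c
  simp only [← hfc, Complex.mul_conj'] at corr
  have parseval : ∑ M, ‖f M‖ ^ 2 =
      Fintype.card (Matrix (Fin n) (Fin n) F) * ∑ S, ‖c S‖ ^ 2 := by
    have := corr 0
    simp only [matrixChar_zero, AddChar.zero_apply, one_mul, add_zero, Complex.mul_conj'] at this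
    exact_mod_cast this
  have fibre : ((Fintype.card (Fin n → F) * ∑ M : Matrix (Fin n) (Fin n) F,
        (if y = M *ᵥ v then ‖f M‖ ^ 2 else 0) : ℝ) : ℂ) =
      ∑ u, χ (-(u ⬝ᵥ y)) * (Fintype.card (Matrix (Fin n) (Fin n) F) *
        ∑ S, c S * starRingEnd ℂ (c (S + Matrix.vecMulVec u v))) := by
    simp only [← corr, Finset.mul_sum, matrixChar_vecMulVec]
    rw [Finset.sum_comm]
    push_cast
    refine Finset.sum_congr rfl fun M _ => ?_
    have := sum_char_dotProduct hχ (M *ᵥ v - y)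
    simp only [dotProduct_sub, sub_eq_add_neg _ (_ ⬝ᵥ y), AddChar.map_add_eq_mul] at this
    have h2 : ∀ u : Fin n → F, χ (-(u ⬝ᵥ y)) * (χ (u ⬝ᵥ M *ᵥ v) * (‖f M‖ : ℂ) ^ 2) =
        (χ (u ⬝ᵥ M *ᵥ v) * χ (-(u ⬝ᵥ y))) * (‖f M‖ : ℂ) ^ 2 := fun u => by ring
    simp only [h2, ← Finset.sum_mul, this, sub_eq_zero, eq_comm (a := y)]
    split_ifs <;> simp
  have hnonneg : 0 ≤ (Fintype.card (Fin n → F) * ∑ M : Matrix (Fin n) (Fin n) F,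
        (if y = M *ᵥ v then ‖f M‖ ^ 2 else 0) : ℝ) :=
    mul_nonneg (Nat.cast_nonneg _) (Finset.sum_nonneg fun M _ => by split_ifs <;> positivity)
  rw [← Complex.norm_of_nonneg hnonneg, fibre, parseval]
  calc _ ≤ ∑ u, (Fintype.card (Matrix (Fin n) (Fin n) F) : ℝ) *
        ∑ S, ‖c S‖ * ‖c (S + Matrix.vecMulVec u v)‖ := by
        refine (norm_sum_le _ _).trans (Finset.sum_le_sum fun u _ => ?_)
        rw [norm_mul, AddChar.norm_apply, one_mul, norm_mul, Complex.norm_natCast]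
        gcongr
        refine (norm_sum_le _ _).trans (le_of_eq ?_)
        simp
    _ ≤ _ := by
        rw [← Finset.mul_sum, mul_left_comm]
        gcongr
        exact sum_norm_mul_norm_shift_le hN hc

/-! ### Query algorithms as maps on states -/

/-- The permutation of basis labels by which `U_M` acts. -/
def matrixQueryEquiv {W : Type} (M : Matrix (Fin n) (Fin n) F) : Equiv.Perm (QBasis F n W) where
  toFun := matrixQueryMap M
  invFun := matrixQueryMap (-M)
  left_inv := by rintro ⟨⟨j, k, z⟩, r⟩; simp [matrixQueryMap]
  right_inv := by rintro ⟨⟨j, k, z⟩, r⟩; simp [matrixQueryMap]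

/-- The permutation of basis labels by which `U_v` acts. -/
def vectorQueryEquiv {W : Type} (v : Fin n → F) : Equiv.Perm (QBasis F n W) where
  toFun := vectorQueryMap v
  invFun := vectorQueryMap (-v)
  left_inv := by rintro ⟨q, ⟨j, z⟩, r⟩; simp [vectorQueryMap]
  right_inv := by rintro ⟨q, ⟨j, z⟩, r⟩; simp [vectorQueryMap]

lemma basisMapMatrix_mulVec {B : Type} [Fintype B] [DecidableEq B] (e : Equiv.Perm B)
    (ψ : B → ℂ) (b : B) : (basisMapMatrix e *ᵥ ψ) b = ψ (e.symm b) := by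
  simp only [Matrix.mulVec, dotProduct, basisMapMatrix, Matrix.of_apply, ite_mul, one_mul,
    zero_mul]
  rw [Finset.sum_eq_single (e.symm b)]
  · simp
  · intro c _ hc
    rw [if_neg]
    rintro rfl
    simp at hc
  · simp

lemma sum_norm_sq_basisMapMatrix_mulVec {B : Type} [Fintype B] [DecidableEq B]
    (e : Equiv.Perm B) (ψ : B → ℂ) :
    ∑ b, ‖(basisMapMatrix e *ᵥ ψ) b‖ ^ 2 = ∑ b, ‖ψ b‖ ^ 2 := by
  simp only [basisMapMatrix_mulVec]
  exact Equiv.sum_comp e.symm fun b => ‖ψ b‖ ^ 2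

lemma sum_norm_sq_unitary_mulVec {B : Type} [Fintype B] [DecidableEq B]
    (U : Matrix.unitaryGroup B ℂ) (ψ : B → ℂ) :
    ∑ b, ‖((U : Matrix B B ℂ) *ᵥ ψ) b‖ ^ 2 = ∑ b, ‖ψ b‖ ^ 2 := by
  have h : ∀ φ : B → ℂ, ((∑ b, ‖φ b‖ ^ 2 : ℝ) : ℂ) = star φ ⬝ᵥ φ := fun φ => by
    simp [dotProduct, Complex.conj_mul']
  have hU : (U : Matrix B B ℂ)ᴴ * (U : Matrix B B ℂ) = 1 := Matrix.mem_unitaryGroup_iff'.mp U.2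
  have : ((∑ b, ‖((U : Matrix B B ℂ) *ᵥ ψ) b‖ ^ 2 : ℝ) : ℂ) = ((∑ b, ‖ψ b‖ ^ 2 : ℝ) : ℂ) := by
    rw [h, h, Matrix.star_mulVec, ← Matrix.dotProduct_mulVec, Matrix.mulVec_mulVec, hU,
      Matrix.one_mulVec]
  exact_mod_cast this

namespace QGate

variable {W : Type} [Fintype W] [DecidableEq W]

lemma sum_norm_sq_mulVec (g : QGate F n W) (M : Matrix (Fin n) (Fin n) F) (v : Fin n → F)
    (ψ : QBasis F n W → ℂ) : ∑ b, ‖(g.toMatrix M v *ᵥ ψ) b‖ ^ 2 = ∑ b, ‖ψ b‖ ^ 2 := by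
  cases g with
  | unitary U => exact sum_norm_sq_unitary_mulVec U ψ
  | queryMatrix => exact sum_norm_sq_basisMapMatrix_mulVec (matrixQueryEquiv M) ψ
  | queryVector => exact sum_norm_sq_basisMapMatrix_mulVec (vectorQueryEquiv v) ψ

/-- A step raises the weight of the amplitudes, as functions of `M`, by at most the number of its
queries to `U_M`. -/
lemma mulVec_mem_lowWeight {χ : AddChar F ℂ} (hχ : χ.IsPrimitive) (g : QGate F n W)
    (v : Fin n → F) {t : ℕ} {ψ : Matrix (Fin n) (Fin n) F → QBasis F n W → ℂ}
    (hψ : ∀ b, (fun M => ψ M b) ∈ lowWeight χ n t) (b : QBasis F n W) :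
    (fun M => (g.toMatrix M v *ᵥ ψ M) b) ∈ lowWeight χ n (t + g.matrixCost) := by
  cases g with
  | unitary U =>
    change _ ∈ lowWeight χ n t
    convert (lowWeight χ n t).sum_mem (t := Finset.univ)
      (f := fun c => (U : Matrix (QBasis F n W) (QBasis F n W) ℂ) b c • fun M => ψ M c)
      (fun c _ => Submodule.smul_mem _ _ (hψ c)) using 1
    ext M
    simp [toMatrix, Matrix.mulVec, dotProduct]
  | queryMatrix =>
    obtain ⟨⟨j, k, z⟩, r⟩ := b
    change _ ∈ lowWeight χ n (t + 1)
    -- the old label of the entry register is `z - M j k`, so that `M j k` is tested against `z - y`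
    convert (lowWeight χ n (t + 1)).sum_mem (t := Finset.univ)
      (f := fun y : F => fun M : Matrix (Fin n) (Fin n) F =>
        if M j k = z - y then ψ M ((j, k, y), r) else 0)
      (fun y _ => ite_entry_eq_mem_lowWeight hχ (hψ _) j k (z - y)) using 1
    ext M
    have := basisMapMatrix_mulVec (matrixQueryEquiv M) (ψ M) ((j, k, z), r)
    rw [Finset.sum_apply, Finset.sum_eq_single (z - M j k)]
    · rw [if_pos (by ring)]
      refine this.trans ?_
      simp [matrixQueryEquiv, matrixQueryMap, sub_eq_add_neg]
    · intro y _ hy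
      rw [if_neg]
      intro h
      exact hy (by rw [h]; ring)
    · simp
  | queryVector =>
    have : ∀ M, ((QGate.queryVector : QGate F n W).toMatrix M v *ᵥ ψ M) b =
        ψ M ((vectorQueryEquiv v).symm b) :=
      fun M => basisMapMatrix_mulVec (vectorQueryEquiv v) (ψ M) b
    simp only [this]
    exact hψ _

end QGate

namespace QueryAlgorithm

lemma sum_norm_sq_finalState (A : QueryAlgorithm F n) (M : Matrix (Fin n) (Fin n) F)
    (v : Fin n → F) : ∑ b, ‖A.finalState M v b‖ ^ 2 = 1 := by
  have h : ∀ (l : List (QGate F n A.W)) (ψ : QBasis F n A.W → ℂ),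
      ∑ b, ‖l.foldl (fun ψ g => g.toMatrix M v *ᵥ ψ) ψ b‖ ^ 2 = ∑ b, ‖ψ b‖ ^ 2 := by
    intro l
    induction l with
    | nil => simp
    | cons g l ih =>
      intro ψ
      rw [List.foldl_cons, ih, g.sum_norm_sq_mulVec]
  rw [finalState, h, Finset.sum_eq_single A.init]
  · simp
  · intro b _ hb; simp [hb]
  · simp

lemma finalState_mem_lowWeight {χ : AddChar F ℂ} (hχ : χ.IsPrimitive) (A : QueryAlgorithm F n)
    (v : Fin n → F) (b : QBasis F n A.W) :
    (fun M => A.finalState M v b) ∈ lowWeight χ n A.matrixQueries := by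
  have h : ∀ (l : List (QGate F n A.W)) (t : ℕ)
      (ψ : Matrix (Fin n) (Fin n) F → QBasis F n A.W → ℂ),
      (∀ b, (fun M => ψ M b) ∈ lowWeight χ n t) →
      (fun M => l.foldl (fun φ g => g.toMatrix M v *ᵥ φ) (ψ M) b) ∈
        lowWeight χ n (t + (l.map QGate.matrixCost).sum) := by
    intro l
    induction l with
    | nil => intro t ψ hψ; simpa using hψ b
    | cons g l ih =>
      intro t ψ hψ
      simp only [List.foldl_cons, List.map_cons, List.sum_cons, ← add_assoc]
      exact ih (t + g.matrixCost) (fun M => g.toMatrix M v *ᵥ ψ M)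
        (fun b => g.mulVec_mem_lowWeight hχ v hψ b)
  have := h A.gates 0 (fun _ => Pi.single A.init 1) (fun b => const_mem_lowWeight χ 0 _)
  rwa [zero_add] at this

lemma successProb_le_one (A : QueryAlgorithm F n) (M : Matrix (Fin n) (Fin n) F)
    (v : Fin n → F) : A.successProb M v ≤ 1 := by
  rw [← A.sum_norm_sq_finalState M v]
  refine Finset.sum_le_sum fun b _ => ?_
  split_ifs
  · exact le_rfl
  · positivity

/-- For fixed `v`, the average over `M` of the success probability is at most the largest
fraction of the `u` for which a shift by `u vᵀ` keeps a matrix light. -/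
lemma sum_successProb_le (A : QueryAlgorithm F n) {N : ℝ} {v : Fin n → F}
    (hN : ∀ S, ((lightShifts A.matrixQueries v S).card : ℝ) ≤ N) :
    Fintype.card (Fin n → F) * ∑ M, A.successProb M v ≤
      N * Fintype.card (Matrix (Fin n) (Fin n) F) := by
  have hχ := AddChar.FiniteField.primitiveChar_to_Complex_isPrimitive F
  have h := Finset.sum_le_sum fun b (_ : b ∈ Finset.univ) =>
    sum_fibre_norm_sq_le hχ hN (A.finalState_mem_lowWeight hχ v b) b.2.2.1
  rw [← Finset.mul_sum, ← Finset.mul_sum, Finset.sum_comm,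
    Finset.sum_comm (f := fun b M => ‖A.finalState M v b‖ ^ 2)] at h
  simpa [sum_norm_sq_finalState, successProb, outputProb] using h

end QueryAlgorithm

/-! ### Counting the vectors with many bad entries -/

/-- A Chernoff bound: if at most one value is bad for each coordinate, then few vectors are bad in
nine tenths of their coordinates. -/
lemma card_mostly_mem_le (B : Fin n → Finset F) (hB : ∀ i, (B i).card ≤ 1) :
    (({u : Fin n → F | 9 * n ≤ 10 * ({i | u i ∈ B i} : Finset (Fin n)).card} :
        Finset (Fin n → F)).card : ℝ) ≤
      Fintype.card (Fin n → F) * Real.exp (-(n : ℝ) / 25) := by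
  set q : ℝ := (Fintype.card F : ℝ) with hq
  have hq2 : (2 : ℝ) ≤ q := Nat.ofNat_le_cast.mpr (Fintype.one_lt_card (α := F))
  have he : Real.exp 1 < 2.72 := Real.exp_one_lt_d9.trans (by norm_num)
  have he1 : 1 < Real.exp 1 := by simp
  have mgf : ∑ u : Fin n → F, Real.exp (({i | u i ∈ B i} : Finset (Fin n)).card) ≤
      (q * Real.exp 0.86) ^ n := by
    have h1 : ∀ u : Fin n → F, Real.exp (({i | u i ∈ B i} : Finset (Fin n)).card) =
        ∏ i, (if u i ∈ B i then Real.exp 1 else 1) := fun u => by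
      rw [Finset.prod_ite, Finset.prod_const_one, mul_one, Finset.prod_const, ← Real.exp_nat_mul,
        mul_one]
    have h2 := Finset.prod_univ_sum (fun _ : Fin n => (Finset.univ : Finset F))
      (fun i x => if x ∈ B i then Real.exp 1 else 1)
    rw [Fintype.piFinset_univ] at h2
    simp only [h1]
    rw [← h2]
    have h3 : ∀ i, ∑ x, (if x ∈ B i then Real.exp 1 else 1) ≤ q * Real.exp 0.86 := by
      intro i
      have h4 : ∑ x, (if x ∈ B i then Real.exp 1 else 1) =
          q + (B i).card * (Real.exp 1 - 1) := by
        have : ∀ x, (if x ∈ B i then Real.exp 1 else 1) =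
            1 + (if x ∈ B i then Real.exp 1 - 1 else 0) := fun x => by split_ifs <;> ring
        simp only [this, Finset.sum_add_distrib]
        simp only [hq, Finset.sum_const, Finset.card_univ, nsmul_eq_mul, mul_one, Finset.sum_ite_mem,
          Finset.univ_inter]
      have h5 : ((B i).card : ℝ) ≤ 1 := by exact_mod_cast hB i
      have h6 : (0.86 : ℝ) + 1 ≤ Real.exp 0.86 := Real.add_one_le_exp _
      rw [h4]
      nlinarith
    calc _ ≤ ∏ _i : Fin n, q * Real.exp 0.86 :=
          Finset.prod_le_prod (fun i _ => Finset.sum_nonneg fun x _ => by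
            split_ifs <;> positivity) (fun i _ => h3 i)
      _ = _ := by simp
  have markov : (({u : Fin n → F | 9 * n ≤ 10 * ({i | u i ∈ B i} : Finset (Fin n)).card} :
        Finset (Fin n → F)).card : ℝ) * Real.exp (0.9 * n) ≤
      ∑ u : Fin n → F, Real.exp (({i | u i ∈ B i} : Finset (Fin n)).card) := by
    rw [← nsmul_eq_mul, ← Finset.sum_const]
    refine (Finset.sum_le_sum fun u hu => ?_).trans
      (Finset.sum_le_univ_sum_of_nonneg fun u => (Real.exp_pos _).le)
    rw [Real.exp_le_exp]
    have : (9 * n : ℝ) ≤ 10 * (({i | u i ∈ B i} : Finset (Fin n)).card : ℝ) := by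
      exact_mod_cast (Finset.mem_filter.mp hu).2
    linarith
  have h := markov.trans mgf
  rw [mul_pow, ← Real.exp_nat_mul] at h
  rw [← le_div_iff₀ (Real.exp_pos _), mul_div_assoc, ← Real.exp_sub] at h
  refine h.trans (le_of_eq ?_)
  rw [Fintype.card_fun, Fintype.card_fin]
  push_cast
  congr 2
  ring

lemma card_sparse_le :
    (({v : Fin n → F | 10 * hammingNorm v ≤ n} : Finset (Fin n → F)).card : ℝ) ≤
      Fintype.card (Fin n → F) * Real.exp (-(n : ℝ) / 25) := by
  refine le_trans ?_ (card_mostly_mem_le (fun _ : Fin n => ({0} : Finset F)) (by simp))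
  refine Nat.cast_le.mpr (Finset.card_le_card (Finset.monotone_filter_right _ fun v _ h => ?_))
  have := Finset.card_filter_add_card_filter_not (s := (Finset.univ : Finset (Fin n)))
    (fun i => v i = 0)
  simp only [Finset.card_univ, Fintype.card_fin] at this
  simp only [Finset.mem_singleton]
  simp only [hammingNorm, ne_eq] at h
  omega

/-- A budget far below `n²` leaves at least nine tenths of the rows of `S + u vᵀ` light. In each row
only one value of `u i` does so, because two rows that differ by a multiple of the dense vector `v`
cannot both be light. -/
lemma card_lightShifts_le {t : ℕ} (ht : 200 * t < n ^ 2) {v : Fin n → F}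
    (hv : n < 10 * hammingNorm v) (S : Matrix (Fin n) (Fin n) F) :
    ((lightShifts t v S).card : ℝ) ≤
      Fintype.card (Fin n → F) * Real.exp (-(n : ℝ) / 25) := by
  refine le_trans ?_ (card_mostly_mem_le
    (fun i => ({x | 20 * hammingNorm (S i + x • v) ≤ n} : Finset F)) fun i => ?_)
  · unfold lightShifts
    refine Nat.cast_le.mpr
      (Finset.card_le_card (Finset.monotone_filter_right _ fun u _ hu => ?_))
    by_contra hlt
    rw [not_le] at hlt
    simp only [Finset.mem_filter, Finset.mem_univ, true_and] at hlt
    have hsplit := Finset.card_filter_add_card_filter_not (s := (Finset.univ : Finset (Fin n)))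
      (fun i => 20 * hammingNorm (S i + u i • v) ≤ n)
    simp only [Finset.card_univ, Fintype.card_fin] at hsplit
    set H : Finset (Fin n) := {i | ¬ 20 * hammingNorm (S i + u i • v) ≤ n}
    have hH : n ≤ 10 * H.card := by omega
    have hw : H.card * n ≤ 20 * matrixWeight (S + Matrix.vecMulVec u v) := by
      rw [matrixWeight, Finset.mul_sum, ← smul_eq_mul, ← Finset.sum_const]
      refine (Finset.sum_le_sum fun i hi => ?_).trans
        (Finset.sum_le_univ_sum_of_nonneg fun i => Nat.zero_le _)
      exact (not_le.mp (Finset.mem_filter.mp hi).2).le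
    nlinarith
  · rw [Finset.card_le_one]
    intro x hx y hy
    by_contra hxy
    simp only [Finset.mem_filter, Finset.mem_univ, true_and] at hx hy
    have h1 : hammingNorm v = hammingNorm (-(S i + x • v) + (S i + y • v)) := by
      have : -(S i + x • v) + (S i + y • v) = (y - x) • v := by rw [sub_smul]; abel
      rw [this, hammingNorm_smul]
      exact fun _ => (IsRegular.of_ne_zero (sub_ne_zero.mpr (Ne.symm hxy))).left.isSMulRegular
    have h2 := hammingDist_triangle (S i + x • v) 0 (S i + y • v)
    rw [hammingDist_zero_right, hammingDist_zero_left, hammingDist_eq_hammingNorm, ← h1] at h2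
    omega

/-! ### The average-case query lower bound -/

/-- With fewer than `n² / 200` queries to `U_M`, and any number
of queries to `U_v`, the average success probability is exponentially small in `n`. -/
theorem QueryAlgorithm.averageSuccess_le (A : QueryAlgorithm F n)
    (hA : 200 * A.matrixQueries < n ^ 2) :
    A.averageSuccess ≤ 2 * Real.exp (-(n : ℝ) / 25) := by
  set ε := Real.exp (-(n : ℝ) / 25)
  set X : ℝ := (Fintype.card (Matrix (Fin n) (Fin n) F) : ℝ)
  set Y : ℝ := (Fintype.card (Fin n → F) : ℝ)
  have hX : 0 < X := Nat.cast_pos.mpr Fintype.card_pos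
  have hY : 0 < Y := Nat.cast_pos.mpr Fintype.card_pos
  have hε : 0 < ε := Real.exp_pos _
  have hv : ∀ v : Fin n → F, ∑ M, A.successProb M v ≤
      X * ε + if 10 * hammingNorm v ≤ n then X else 0 := by
    intro v
    split_ifs with h
    · have h1 : ∑ M, A.successProb M v ≤ ∑ _M : Matrix (Fin n) (Fin n) F, (1 : ℝ) :=
        Finset.sum_le_sum fun M _ => A.successProb_le_one M v
      rw [Finset.sum_const, Finset.card_univ, nsmul_one] at h1
      have : 0 ≤ X * ε := by positivity
      linarith
    · have h1 := A.sum_successProb_le (card_lightShifts_le hA (not_le.mp h))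
      have h2 : Y * ∑ M, A.successProb M v ≤ Y * (X * ε) := h1.trans (le_of_eq (by ring))
      rw [add_zero]
      exact le_of_mul_le_mul_left h2 hY
  have hsum : ∑ M, ∑ v, A.successProb M v ≤ 2 * ε * (X * Y) := by
    rw [Finset.sum_comm]
    refine (Finset.sum_le_sum fun v _ => hv v).trans ?_
    rw [Finset.sum_add_distrib, Finset.sum_const, ← Finset.sum_filter, Finset.sum_const,
      nsmul_eq_mul, nsmul_eq_mul, Finset.card_univ]
    have := mul_le_mul_of_nonneg_right (card_sparse_le (F := F) (n := n)) hX.le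
    change Y * (X * ε) + _ ≤ _
    change _ ≤ Y * ε * X at this
    linarith
  exact (div_le_iff₀ (by positivity)).mpr hsum

/-! ### The algorithm that reads its whole input -/

lemma basisMapMatrix_mulVec_single {B : Type} [Fintype B] [DecidableEq B] (f : B → B) (b : B) :
    basisMapMatrix f *ᵥ Pi.single b 1 = Pi.single (f b) 1 := by
  ext c
  simp [basisMapMatrix, Pi.single_apply]

lemma basisMapMatrix_mem_unitaryGroup {B : Type} [Fintype B] [DecidableEq B]
    (e : Equiv.Perm B) : basisMapMatrix e ∈ Matrix.unitaryGroup B ℂ := by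
  rw [Matrix.mem_unitaryGroup_iff']
  ext a c
  simp [Matrix.mul_apply, Matrix.star_apply, basisMapMatrix, Matrix.one_apply, eq_comm]

/-- The unitary step that permutes the computational basis by `e`. -/
def QGate.perm {W : Type} [Fintype W] [DecidableEq W] (e : Equiv.Perm (QBasis F n W)) :
    QGate F n W :=
  .unitary ⟨basisMapMatrix e, basisMapMatrix_mem_unitaryGroup e⟩

namespace BruteForce

-- equality of labels with this workspace is decided through a long chain of product instances
set_option synthInstance.maxSize 1000

/-- The workspace: room for a copy of the matrix and for a copy of the vector. -/
abbrev Memory (F : Type) (n : ℕ) : Type := Matrix (Fin n) (Fin n) F × (Fin n → F)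

/-- Transposing `i₀` with `j` and with `k` on the index registers, so that the resting position
`(i₀, i₀)` of the matrix-query register becomes `(j, k)`. -/
def aimMatrix (i₀ j k : Fin n) : Equiv.Perm (QBasis F n (Memory F n)) where
  toFun | ((a, b, z), r) => ((Equiv.swap i₀ j a, Equiv.swap i₀ k b, z), r)
  invFun | ((a, b, z), r) => ((Equiv.swap i₀ j a, Equiv.swap i₀ k b, z), r)
  left_inv := by rintro ⟨⟨a, b, z⟩, r⟩; simp
  right_inv := by rintro ⟨⟨a, b, z⟩, r⟩; simp

/-- Adding the value register of the matrix query to the memory cell `(j, k)`. -/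
def storeMatrix (j k : Fin n) : Equiv.Perm (QBasis F n (Memory F n)) where
  toFun | ((a, b, z), q, y, (m, w)) => ((a, b, z), q, y, (m + Matrix.single j k z, w))
  invFun | ((a, b, z), q, y, (m, w)) => ((a, b, z), q, y, (m - Matrix.single j k z, w))
  left_inv := by rintro ⟨⟨a, b, z⟩, q, y, m, w⟩; simp
  right_inv := by rintro ⟨⟨a, b, z⟩, q, y, m, w⟩; simp

/-- Subtracting the memory cell `(j, k)` from the value register of the matrix query. -/
def clearMatrix (j k : Fin n) : Equiv.Perm (QBasis F n (Memory F n)) where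
  toFun | ((a, b, z), q, y, (m, w)) => ((a, b, z - m j k), q, y, (m, w))
  invFun | ((a, b, z), q, y, (m, w)) => ((a, b, z + m j k), q, y, (m, w))
  left_inv := by rintro ⟨⟨a, b, z⟩, q, y, m, w⟩; simp
  right_inv := by rintro ⟨⟨a, b, z⟩, q, y, m, w⟩; simp

/-- Transposing `i₀` with `j` on the index of the vector-query register. -/
def aimVector (i₀ j : Fin n) : Equiv.Perm (QBasis F n (Memory F n)) where
  toFun | (q, (a, z), r) => (q, (Equiv.swap i₀ j a, z), r)
  invFun | (q, (a, z), r) => (q, (Equiv.swap i₀ j a, z), r)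
  left_inv := by rintro ⟨q, ⟨a, z⟩, r⟩; simp
  right_inv := by rintro ⟨q, ⟨a, z⟩, r⟩; simp

/-- Adding the value register of the vector query to the memory cell `j`. -/
def storeVector (j : Fin n) : Equiv.Perm (QBasis F n (Memory F n)) where
  toFun | (q, (a, z), y, (m, w)) => (q, (a, z), y, (m, w + Pi.single j z))
  invFun | (q, (a, z), y, (m, w)) => (q, (a, z), y, (m, w - Pi.single j z))
  left_inv := by rintro ⟨q, ⟨a, z⟩, y, m, w⟩; simp
  right_inv := by rintro ⟨q, ⟨a, z⟩, y, m, w⟩; simp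

/-- Subtracting the memory cell `j` from the value register of the vector query. -/
def clearVector (j : Fin n) : Equiv.Perm (QBasis F n (Memory F n)) where
  toFun | (q, (a, z), y, (m, w)) => (q, (a, z - w j), y, (m, w))
  invFun | (q, (a, z), y, (m, w)) => (q, (a, z + w j), y, (m, w))
  left_inv := by rintro ⟨q, ⟨a, z⟩, y, m, w⟩; simp
  right_inv := by rintro ⟨q, ⟨a, z⟩, y, m, w⟩; simp

/-- Adding the product of the stored matrix and the stored vector to the output register. -/
def multiply : Equiv.Perm (QBasis F n (Memory F n)) where
  toFun | (q, q', y, (m, w)) => (q, q', y + m *ᵥ w, (m, w))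
  invFun | (q, q', y, (m, w)) => (q, q', y - m *ᵥ w, (m, w))
  left_inv := by rintro ⟨q, q', y, m, w⟩; simp
  right_inv := by rintro ⟨q, q', y, m, w⟩; simp

/-- The steps that copy entry `(j, k)` of the matrix to the memory, with a single query. -/
def readMatrix (i₀ : Fin n) (p : Fin n × Fin n) : List (QGate F n (Memory F n)) :=
  [.perm (aimMatrix i₀ p.1 p.2), .queryMatrix, .perm (storeMatrix p.1 p.2),
    .perm (clearMatrix p.1 p.2), .perm (aimMatrix i₀ p.1 p.2)]

/-- The steps that copy entry `j` of the vector to the memory, with a single query. -/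
def readVector (i₀ : Fin n) (j : Fin n) : List (QGate F n (Memory F n)) :=
  [.perm (aimVector i₀ j), .queryVector, .perm (storeVector j), .perm (clearVector j),
    .perm (aimVector i₀ j)]

/-- The basis state with memory content `m`, `w` and all other registers at rest. -/
def rest (i₀ : Fin n) (m : Matrix (Fin n) (Fin n) F) (w : Fin n → F) :
    QBasis F n (Memory F n) :=
  ((i₀, i₀, 0), (i₀, 0), 0, (m, w))

variable (M : Matrix (Fin n) (Fin n) F) (v : Fin n → F)

lemma perm_mulVec_single {W : Type} [Fintype W] [DecidableEq W]
    (e : Equiv.Perm (QBasis F n W)) (b : QBasis F n W) :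
    (QGate.perm e).toMatrix M v *ᵥ Pi.single b 1 = Pi.single (e b) 1 :=
  basisMapMatrix_mulVec_single e b

lemma queryMatrix_mulVec_single {W : Type} [Fintype W] [DecidableEq W] (b : QBasis F n W) :
    QGate.queryMatrix.toMatrix M v *ᵥ Pi.single b 1 = Pi.single (matrixQueryMap M b) 1 :=
  basisMapMatrix_mulVec_single _ b

lemma queryVector_mulVec_single {W : Type} [Fintype W] [DecidableEq W] (b : QBasis F n W) :
    QGate.queryVector.toMatrix M v *ᵥ Pi.single b 1 = Pi.single (vectorQueryMap v b) 1 :=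
  basisMapMatrix_mulVec_single _ b

lemma foldl_readMatrix (i₀ : Fin n) (p : Fin n × Fin n) {m : Matrix (Fin n) (Fin n) F}
    (hm : m p.1 p.2 = 0) (w : Fin n → F) :
    (readMatrix i₀ p).foldl (fun ψ g => g.toMatrix M v *ᵥ ψ) (Pi.single (rest i₀ m w) 1) =
      Pi.single (rest i₀ (m + Matrix.single p.1 p.2 (M p.1 p.2)) w) 1 := by
  simp only [readMatrix, List.foldl_cons, List.foldl_nil, perm_mulVec_single,
    queryMatrix_mulVec_single]
  congr 1
  simp [rest, aimMatrix, storeMatrix, clearMatrix, matrixQueryMap, hm]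

lemma foldl_readVector (i₀ : Fin n) (j : Fin n) (m : Matrix (Fin n) (Fin n) F)
    {w : Fin n → F} (hw : w j = 0) :
    (readVector i₀ j).foldl (fun ψ g => g.toMatrix M v *ᵥ ψ) (Pi.single (rest i₀ m w) 1) =
      Pi.single (rest i₀ m (w + Pi.single j (v j))) 1 := by
  simp only [readVector, List.foldl_cons, List.foldl_nil, perm_mulVec_single,
    queryVector_mulVec_single]
  congr 1
  simp [rest, aimVector, storeVector, clearVector, vectorQueryMap, hw]

lemma foldl_flatMap_readMatrix (i₀ : Fin n) (w : Fin n → F) (l : List (Fin n × Fin n))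
    (hl : l.Nodup) (m : Matrix (Fin n) (Fin n) F) (hm : ∀ p ∈ l, m p.1 p.2 = 0) :
    (l.flatMap (readMatrix i₀)).foldl (fun ψ g => g.toMatrix M v *ᵥ ψ)
        (Pi.single (rest i₀ m w) 1) =
      Pi.single (rest i₀
        (m + (l.map fun p => Matrix.single p.1 p.2 (M p.1 p.2)).sum) w) 1 := by
  induction l generalizing m with
  | nil => simp
  | cons p l ih =>
    obtain ⟨hp, hl⟩ := List.nodup_cons.mp hl
    rw [List.flatMap_cons, List.foldl_append,
      foldl_readMatrix M v i₀ p (hm p List.mem_cons_self), ih hl, List.map_cons, List.sum_cons,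
      add_assoc]
    intro q hq
    have hne : ¬ (p.1 = q.1 ∧ p.2 = q.2) := fun h => hp (Prod.ext h.1 h.2 ▸ hq)
    simp [hm q (List.mem_cons_of_mem _ hq), hne]

lemma foldl_flatMap_readVector (i₀ : Fin n) (m : Matrix (Fin n) (Fin n) F) (l : List (Fin n))
    (hl : l.Nodup) (w : Fin n → F) (hw : ∀ j ∈ l, w j = 0) :
    (l.flatMap (readVector i₀)).foldl (fun ψ g => g.toMatrix M v *ᵥ ψ)
        (Pi.single (rest i₀ m w) 1) =
      Pi.single (rest i₀ m (w + (l.map fun j => Pi.single j (v j)).sum)) 1 := by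
  induction l generalizing w with
  | nil => simp
  | cons j l ih =>
    obtain ⟨hj, hl⟩ := List.nodup_cons.mp hl
    rw [List.flatMap_cons, List.foldl_append,
      foldl_readVector M v i₀ j m (hw j List.mem_cons_self), ih hl, List.map_cons, List.sum_cons,
      add_assoc]
    intro i hi
    have hne : i ≠ j := fun h => hj (h ▸ hi)
    simp [hw i (List.mem_cons_of_mem _ hi), hne]

/-- Reading the matrix, reading the vector, and multiplying. -/
noncomputable def gates (F : Type) [Field F] [Fintype F] [DecidableEq F] (i₀ : Fin n) :
    List (QGate F n (Memory F n)) :=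
  Finset.univ.toList.flatMap (readMatrix i₀) ++
    (Finset.univ.toList.flatMap (readVector i₀) ++ [.perm multiply])

lemma foldl_gates (i₀ : Fin n) :
    (gates F i₀).foldl (fun ψ g => g.toMatrix M v *ᵥ ψ) (Pi.single (rest i₀ 0 0) 1) =
      Pi.single ((i₀, i₀, 0), (i₀, 0), M *ᵥ v, (M, v)) 1 := by
  have hM : 0 + ((Finset.univ : Finset (Fin n × Fin n)).toList.map
      fun p => Matrix.single p.1 p.2 (M p.1 p.2)).sum = M := by
    rw [Finset.sum_map_toList, zero_add, Fintype.sum_prod_type]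
    exact (Matrix.matrix_eq_sum_single M).symm
  have hv : 0 + ((Finset.univ : Finset (Fin n)).toList.map
      fun j => Pi.single j (v j)).sum = v := by
    rw [Finset.sum_map_toList, zero_add]
    exact Finset.univ_sum_single v
  rw [gates, List.foldl_append, List.foldl_append,
    foldl_flatMap_readMatrix M v i₀ 0 _ (Finset.nodup_toList _) 0 (fun _ _ => rfl), hM,
    foldl_flatMap_readVector M v i₀ M _ (Finset.nodup_toList _) 0 (fun _ _ => rfl), hv,
    List.foldl_cons, List.foldl_nil, perm_mulVec_single]
  simp [multiply, rest]

lemma sum_map_flatMap_const {α β : Type*} {f : α → List β} (cost : β → ℕ) (c : ℕ)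
    (h : ∀ a, ((f a).map cost).sum = c) (l : List α) :
    ((l.flatMap f).map cost).sum = l.length * c := by
  induction l with
  | nil => simp
  | cons a l ih =>
    rw [List.flatMap_cons, List.map_append, List.sum_append, h, ih, List.length_cons]
    ring

lemma sum_matrixCost_gates (i₀ : Fin n) : ((gates F i₀).map QGate.matrixCost).sum = n ^ 2 := by
  rw [gates, List.map_append, List.map_append, List.sum_append, List.sum_append,
    sum_map_flatMap_const QGate.matrixCost 1 fun p => by
      simp [readMatrix, QGate.perm, QGate.matrixCost],
    sum_map_flatMap_const QGate.matrixCost 0 fun j => by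
      simp [readVector, QGate.perm, QGate.matrixCost]]
  simp [QGate.perm, QGate.matrixCost, sq]

lemma sum_vectorCost_gates (i₀ : Fin n) : ((gates F i₀).map QGate.vectorCost).sum = n := by
  rw [gates, List.map_append, List.map_append, List.sum_append, List.sum_append,
    sum_map_flatMap_const QGate.vectorCost 0 fun p => by
      simp [readMatrix, QGate.perm, QGate.vectorCost],
    sum_map_flatMap_const QGate.vectorCost 1 fun j => by
      simp [readVector, QGate.perm, QGate.vectorCost]]
  simp [QGate.perm, QGate.vectorCost]

end BruteForce

set_option synthInstance.maxSize 1000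

namespace QueryAlgorithm

open BruteForce

/-- The algorithm that copies the matrix and the vector entry by entry to its workspace and
multiplies them there. The index `i₀` is the resting position of the query registers. -/
noncomputable def bruteForce (F : Type) [Field F] [Fintype F] [DecidableEq F] (i₀ : Fin n) :
    QueryAlgorithm F n where
  W := Memory F n
  init := rest i₀ 0 0
  gates := BruteForce.gates F i₀

lemma bruteForce_successProb (i₀ : Fin n) (M : Matrix (Fin n) (Fin n) F) (v : Fin n → F) :
    (bruteForce F i₀).successProb M v = 1 := by
  have h : (bruteForce F i₀).finalState M v =
      Pi.single (((i₀, i₀, 0), (i₀, 0), M *ᵥ v, (M, v)) : QBasis F n (Memory F n)) 1 :=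
    foldl_gates M v i₀
  unfold successProb outputProb
  rw [h]
  change ∑ b : QBasis F n (Memory F n), _ = _
  rw [Finset.sum_eq_single ((i₀, i₀, 0), (i₀, 0), M *ᵥ v, (M, v))]
  · simp
  · intro b _ hb
    simp [hb]
  · simp

lemma bruteForce_queries (i₀ : Fin n) :
    (bruteForce F i₀).matrixQueries + (bruteForce F i₀).vectorQueries = n ^ 2 + n :=
  congrArg₂ (· + ·) (sum_matrixCost_gates i₀) (sum_vectorCost_gates i₀)

end QueryAlgorithm

end

theorem mainTheorem5 :
    ∃ C : ℝ, 0 < C ∧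
      ∀ (F : Type) [Field F] [Fintype F] [DecidableEq F]
        (n k d : ℕ) (_hn : n = k * d)
        (α : ℝ) (_hα0 : 0 < α) (_hα1 : α ≤ 1) (_hk : 4 * Real.exp (-(k : ℝ) / 3200) ≤ α)
        (Q : ℕ) (A : QueryAlgorithm F n) (_hQ : A.matrixQueries ≤ Q) (_hA : α ≤ A.averageSuccess),
        ∃ B : QueryAlgorithm F d,
          ((B.matrixQueries + B.vectorQueries : ℕ) : ℝ)
              ≤ C * (α ^ (-2 : ℤ) * ((Q : ℝ) + (n : ℝ) ^ (3 / 2 : ℝ))) ∧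
          ∀ (M : Matrix (Fin d) (Fin d) F) (v : Fin d → F), 0.96 ≤ B.successProb M v := by
  refine ⟨400, by norm_num, ?_⟩
  intro F _ _ _ n k d hn α hα0 hα1 hk Q A hQ hA
  -- the query registers of `A` hold an index in `Fin n`, so `n` is positive
  have hnpos : 0 < n := A.init.1.1.pos
  have hd : 0 < d := Nat.pos_of_mul_pos_left (hn ▸ hnpos)
  have hkn : k ≤ n := hn ▸ Nat.le_mul_of_pos_right k hd
  have hkpos : 0 < k := Nat.pos_of_mul_pos_right (hn ▸ hnpos)
  have hdn : d ≤ n := hn ▸ Nat.le_mul_of_pos_left d hkpos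
  have hlower : n ^ 2 ≤ 200 * Q := by
    by_contra hlt
    have h1 := A.averageSuccess_le (by omega)
    have h2 : Real.exp (-(n : ℝ) / 25) ≤ Real.exp (-(k : ℝ) / 3200) := by
      rw [Real.exp_le_exp]
      have : (k : ℝ) ≤ n := by exact_mod_cast hkn
      have : (0 : ℝ) ≤ k := Nat.cast_nonneg k
      linarith
    have := Real.exp_pos (-(k : ℝ) / 3200)
    linarith
  refine ⟨QueryAlgorithm.bruteForce F ⟨0, hd⟩, ?_, fun M v => ?_⟩
  · rw [QueryAlgorithm.bruteForce_queries]
    have h1 : d ^ 2 + d ≤ 400 * Q := by nlinarith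
    have h2 : ((d ^ 2 + d : ℕ) : ℝ) ≤ 400 * Q := by exact_mod_cast h1
    have h3 : 1 ≤ α ^ (-2 : ℤ) := by
      rw [zpow_neg]
      exact (one_le_inv₀ (by positivity)).mpr (pow_le_one₀ hα0.le hα1)
    have h4 : (0 : ℝ) ≤ (n : ℝ) ^ (3 / 2 : ℝ) := by positivity
    have h5 : (0 : ℝ) ≤ Q := Nat.cast_nonneg Q
    nlinarith
  · rw [QueryAlgorithm.bruteForce_successProb]
    norm_num
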